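/- Let $\alpha,\beta\in(0,1)$ and $\lambda>0$ satisfy $\frac{\beta}{8(1-\alpha)^2}<\lambda<\frac{\beta}{2(1-\alpha)^2}$. Define the tâtonnement map $f$ on prices $p>0$ by $f(p)=p+\lambda\left[\frac{2\beta}{p}-4(1-\alpha)\right]$, put $s=\sqrt{2\lambda\beta}$, and let $E=[f(s),\,f^2(s)+s]$, where $f^k$ denotes the $k$-th iterate. Let $\mathfrak G$ be the class of continuous maps $g$ of a closed interval $[a,b]$ into itself such that (i) there is $m\in(a,b)$ with $g$ strictly decreasing on $[a,m]$ and strictly increasing on $[m,b]$, and (ii) $g(a)>a$, $g(b)<b$, and $g(x)<x$ for all $x\in[m,b)$. A continuous map $g$ of a closed interval $I$ into itself is called turbulent if there are $x_1,x_2,x_3\in I$ with $g(x_2)=g(x_1)=x_1$, $g(x_3)=x_2$, and either $x_1<x_3<x_2$ or $x_2<x_3<x_1$. An odd-period cycle is a periodic orbit whose least period is an odd number greater than $1$. Then: 1. $f$ maps $E$ into $E$, and the restriction $f|_E$ belongs to $\mathfrak G$. 2. $f$ has an odd-period cycle in $(0,\infty)$ if and only if $\frac{25\beta}{72(1-\alpha)^2}<\lambda<\frac{\beta}{2(1-\alpha)^2}$.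 3. The second iterate $(f|_E)^2$ is turbulent if and only if $\frac{25\beta}{72(1-\alpha)^2}\le\lambda<\frac{\beta}{2(1-\alpha)^2}$. -/

import Mathlib

open Set Function

noncomputable section

/-- The excess demand for good `x` at price `p > 0`. -/
def excessDemand (α β p : ℝ) : ℝ := 2 * β / p - 4 * (1 - α)

/-- The tâtonnement map with speed of adjustment `lam`; prices are the positive reals. -/
def tatonnement (α β lam p : ℝ) : ℝ := p + lam * excessDemand α β p

/-- The number `s = √(2 λ β)`. -/
def criticalPrice (β lam : ℝ) : ℝ := √(2 * lam * β)

/-- The closed interval `E = [f(s), f²(s) + s]`. -/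
abbrev priceInterval (α β lam : ℝ) : Set ℝ :=
  Icc (tatonnement α β lam (criticalPrice β lam))
    ((tatonnement α β lam)^[2] (criticalPrice β lam) + criticalPrice β lam)

/-- The class `𝔊` of Deng, Khan and Mitra: continuous self-maps of a closed interval `[a, b]`
that strictly decrease on `[a, m]` and strictly increase on `[m, b]` for some `m ∈ (a, b)`,
and satisfy `g a > a`, `g b < b` and `g x < x` for all `x ∈ [m, b)`. -/
def InClassG {a b : ℝ} (g : Icc a b → Icc a b) : Prop :=
  Continuous g ∧
  ∃ hab : a ≤ b, ∃ m : Icc a b, a < (m : ℝ) ∧ (m : ℝ) < b ∧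
    StrictAntiOn g {x | x ≤ m} ∧ StrictMonoOn g {x | m ≤ x} ∧
    a < (g ⟨a, left_mem_Icc.2 hab⟩ : ℝ) ∧ (g ⟨b, right_mem_Icc.2 hab⟩ : ℝ) < b ∧
    ∀ x : Icc a b, m ≤ x → (x : ℝ) < b → g x < x

/-- A continuous self-map `g` of a closed interval is turbulent. -/
def Turbulent {a b : ℝ} (g : Icc a b → Icc a b) : Prop :=
  Continuous g ∧
  ∃ x₁ x₂ x₃ : Icc a b, g x₂ = x₁ ∧ g x₁ = x₁ ∧ g x₃ = x₂ ∧
    ((x₁ < x₃ ∧ x₃ < x₂) ∨ (x₂ < x₃ ∧ x₃ < x₁))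

/-- `g`, regarded as a map with domain `D`, has a cycle lying in `D` whose (least) period is an
odd number greater than `1`; a fixed point does not count as an odd-period cycle. -/
def HasOddPeriodCycle (D : Set ℝ) (g : ℝ → ℝ) : Prop :=
  ∃ p : ℝ, (∀ k : ℕ, g^[k] p ∈ D) ∧ Odd (minimalPeriod g p) ∧ 1 < minimalPeriod g p

end

/-! Measuring prices in units of `s` turns the tâtonnement map into φ(x) = x + 1/x - κ with κ² =
8(1-α)²λ/β, so the hypotheses say 1 < κ < 2 and the threshold is κ = 5/3. Everything rests on φ(x) =
φ(y) iff x = y or xy = 1. The critical point is 1, the only fixed point is 1/κ, its other preimage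
is κ, and κ ≤ φ²(1) holds exactly when 5/3 ≤ κ (`le_top_iff`). If κ ≤ 5/3, φ exchanges the two sides
of 1/κ in [2-κ, φ²(1)], which rules out odd cycles (`not_odd_cycle`). If κ > 5/3, a backward
φ²-orbit of 1 descends to 1/κ while φ³(1) > 1/κ, and the intermediate value theorem yields an odd
cycle (`exists_odd_cycle`). If κ ≥ 5/3, φ² is turbulent with x₁ = 1/κ and x₂ = κ
(`exists_turbulent`). Otherwise every fixed point of φ², namely 1/κ and the points of a possible
2-cycle, is excluded as x₁ (`not_turbulent`). -/

/-- The tâtonnement map in the unit of account in which its critical point is `1`. -/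
noncomputable def scaledMap (κ x : ℝ) : ℝ := x + x⁻¹ - κ

/-! ### Elementary properties of the scaled map -/

namespace scaledMap

variable {κ x y : ℝ}

theorem sub_eq (hx : 0 < x) (hy : 0 < y) :
    scaledMap κ y - scaledMap κ x = (y - x) * (x * y - 1) / (x * y) := by
  unfold scaledMap
  field_simp
  ring

theorem lt_of_one_lt_mul (hx : 0 < x) (hxy : x < y) (h : 1 < x * y) :
    scaledMap κ x < scaledMap κ y := by
  have hy := hx.trans hxy
  rw [← sub_pos, sub_eq hx hy]
  exact div_pos (mul_pos (sub_pos.2 hxy) (sub_pos.2 h)) (mul_pos hx hy)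

theorem lt_of_mul_lt_one (hx : 0 < x) (hxy : x < y) (h : x * y < 1) :
    scaledMap κ y < scaledMap κ x := by
  have hy := hx.trans hxy
  rw [← sub_neg, sub_eq hx hy]
  exact div_neg_of_neg_of_pos (mul_neg_of_pos_of_neg (sub_pos.2 hxy) (sub_neg.2 h))
    (mul_pos hx hy)

theorem le_of_mul_le_one (hx : 0 < x) (hxy : x ≤ y) (h : x * y ≤ 1) :
    scaledMap κ y ≤ scaledMap κ x := by
  have hy := hx.trans_le hxy
  rw [← sub_nonpos, sub_eq hx hy]
  exact div_nonpos_of_nonpos_of_nonneg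
    (mul_nonpos_of_nonneg_of_nonpos (sub_nonneg.2 hxy) (sub_nonpos.2 h)) (mul_pos hx hy).le

theorem eq_iff (hx : 0 < x) (hy : 0 < y) :
    scaledMap κ x = scaledMap κ y ↔ x = y ∨ x * y = 1 := by
  rw [@eq_comm _ (scaledMap κ x), ← sub_eq_zero, sub_eq hx hy, div_eq_zero_iff,
    or_iff_left (mul_pos hx hy).ne', mul_eq_zero, sub_eq_zero, sub_eq_zero, @eq_comm _ y]

theorem lt_of_le_one (hx : 0 < x) (hxy : x < y) (hy : y ≤ 1) :
    scaledMap κ y < scaledMap κ x :=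
  lt_of_mul_lt_one hx hxy (by nlinarith)

theorem lt_of_one_le (hx : 1 ≤ x) (hxy : x < y) : scaledMap κ x < scaledMap κ y :=
  lt_of_one_lt_mul (by linarith) hxy (by nlinarith)

theorem apply_one : scaledMap κ 1 = 2 - κ := by
  unfold scaledMap
  norm_num

theorem two_sub_le (hx : 0 < x) : 2 - κ ≤ scaledMap κ x := by
  rw [← apply_one]
  rcases lt_trichotomy x 1 with h | rfl | h
  · exact (lt_of_le_one hx h le_rfl).le
  · exact le_rfl
  · exact (lt_of_one_le le_rfl h).le

theorem two_sub_lt (hx : 0 < x) (hx1 : x ≠ 1) : 2 - κ < scaledMap κ x := by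
  rw [← apply_one]
  rcases hx1.lt_or_gt with h | h
  · exact lt_of_le_one hx h le_rfl
  · exact lt_of_one_le le_rfl h

theorem pos (hκ : κ < 2) (hx : 0 < x) : 0 < scaledMap κ x := by
  linarith [two_sub_le (κ := κ) hx]

theorem sub_self_eq (hx : 0 < x) : scaledMap κ x - x = (1 - κ * x) / x := by
  unfold scaledMap
  field_simp
  ring

theorem lt_self (hx : 0 < x) (h : 1 < κ * x) : scaledMap κ x < x := by
  rw [← sub_neg, sub_self_eq hx]
  exact div_neg_of_neg_of_pos (by linarith) hx

theorem eq_self_iff (hx : 0 < x) : scaledMap κ x = x ↔ κ * x = 1 := by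
  rw [← sub_eq_zero, sub_self_eq hx, div_eq_zero_iff, sub_eq_zero]
  simp [hx.ne', eq_comm]

theorem apply_inv : scaledMap κ κ⁻¹ = κ⁻¹ := by
  simp [scaledMap]

theorem apply_self : scaledMap κ κ = κ⁻¹ := by
  simp [scaledMap]

/-- The linear factor carries the fixed point; the roots of the quadratic factor form the 2-cycle,
with sum κ and product 1/2. -/
theorem sq_sub_self (hκ : κ < 2) (hx : 0 < x) :
    scaledMap κ (scaledMap κ x) - x =
      (1 - κ * x) * (2 * x ^ 2 - 2 * κ * x + 1) / (x ^ 2 * scaledMap κ x) := by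
  have h := (pos hκ hx).ne'
  have hs : x * scaledMap κ x = x ^ 2 + 1 - κ * x := by
    unfold scaledMap
    field_simp
  have e : scaledMap κ (scaledMap κ x) = scaledMap κ x + (scaledMap κ x)⁻¹ - κ := rfl
  rw [e]
  generalize scaledMap κ x = u at *
  field_simp
  linear_combination (x * u + 1 - 2 * κ * x) * hs

theorem sq_eq_self (hκ : κ < 2) (hx : 0 < x) (h : scaledMap κ (scaledMap κ x) = x) :
    κ * x = 1 ∨ 2 * x ^ 2 - 2 * κ * x + 1 = 0 := by
  rw [← sub_eq_zero, sq_sub_self hκ hx, div_eq_zero_iff, mul_eq_zero] at h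
  have : x ^ 2 * scaledMap κ x ≠ 0 := by have := pos hκ hx; positivity
  rcases h with (h | h) | h
  · left; linarith
  · exact .inr h
  · exact absurd h this

theorem continuousOn : ContinuousOn (scaledMap κ) (Ioi 0) := by
  unfold scaledMap
  exact (continuousOn_id.add (continuousOn_id.inv₀ fun x hx => (ne_of_gt hx))).sub
    continuousOn_const

theorem mapsTo_pos (hκ : κ < 2) : MapsTo (scaledMap κ) (Ioi 0) (Ioi 0) := fun _ hx => pos hκ hx

theorem iterate_pos (hκ : κ < 2) (hx : 0 < x) (n : ℕ) : 0 < (scaledMap κ)^[n] x :=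
  (mapsTo_pos hκ).iterate n hx

theorem continuousOn_iterate (hκ : κ < 2) (n : ℕ) :
    ContinuousOn (scaledMap κ)^[n] (Ioi 0) :=
  continuousOn.iterate (mapsTo_pos hκ) n

theorem one_lt_top_iff (h1 : 1 < κ) (hκ : κ < 2) : 1 < scaledMap κ (2 - κ) ↔ 3 < 2 * κ := by
  have h2 : 0 < 2 - κ := by linarith
  have e : scaledMap κ (2 - κ) - 1 = (2 * κ - 3) * (κ - 1) / (2 - κ) := by
    unfold scaledMap
    field_simp
    ring
  rw [← sub_pos, e, div_pos_iff_of_pos_right h2, mul_pos_iff_of_pos_right (by linarith), sub_pos]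

theorem top_sub (hκ : κ < 2) :
    scaledMap κ (2 - κ) - κ = (3 * κ - 5) * (κ - 1) / (2 - κ) := by
  have h2 : 0 < 2 - κ := by linarith
  unfold scaledMap
  field_simp
  ring

/-- Source of the constant 5/3. As φ increases beyond 1 and φ(κ) = 1/κ, the left side forces φ³(1)
above the fixed point. -/
theorem lt_top_iff (h1 : 1 < κ) (hκ : κ < 2) : κ < scaledMap κ (2 - κ) ↔ 5 / 3 < κ := by
  rw [← sub_pos, top_sub hκ, div_pos_iff_of_pos_right (by linarith),
    mul_pos_iff_of_pos_right (by linarith)]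
  constructor <;> intro <;> linarith

theorem le_top_iff (h1 : 1 < κ) (hκ : κ < 2) : κ ≤ scaledMap κ (2 - κ) ↔ 5 / 3 ≤ κ := by
  have h : 0 < (κ - 1) / (2 - κ) := div_pos (by linarith) (by linarith)
  rw [← sub_nonneg, top_sub hκ, mul_div_assoc, mul_nonneg_iff_of_pos_right h]
  constructor <;> intro <;> linarith

/-- Up to 1/(2-κ), the partner of the left endpoint under xy = 1, values do not exceed the endpoint
value; beyond it the graph lies below the diagonal. -/
theorem le_max (h1 : 1 < κ) (hκ : κ < 2) (hy : 2 - κ ≤ y) :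
    scaledMap κ y ≤ max (scaledMap κ (2 - κ)) y := by
  rcases le_or_gt ((2 - κ) * y) 1 with h | h
  · exact (le_of_mul_le_one (by linarith) hy h).trans (le_max_left _ _)
  · exact (lt_self (by linarith) (by nlinarith)).le.trans (le_max_right _ _)

theorem inv_lt_top (h1 : 1 < κ) (hκ : κ < 2) : κ⁻¹ < scaledMap κ (2 - κ) := by
  have h0 : κ * κ⁻¹ = 1 := mul_inv_cancel₀ (by linarith)
  have h3 : κ⁻¹ < 1 := inv_lt_one_of_one_lt₀ h1
  have := lt_of_le_one (κ := κ) (x := 2 - κ) (y := κ⁻¹) (by linarith)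
    (by rw [← sub_pos]; have : κ⁻¹ - (2 - κ) = (κ - 1) ^ 2 * κ⁻¹ := by field_simp; ring
        rw [this]; have : 0 < κ - 1 := by linarith
        positivity) h3.le
  rwa [apply_inv] at this

/-! ### The second iterate -/

theorem exists_turbulent (h1 : 5 / 3 ≤ κ) (hκ : κ < 2) :
    ∃ x ∈ Ioc κ⁻¹ 1, scaledMap κ (scaledMap κ x) = κ := by
  have hi : 0 < κ⁻¹ := inv_pos.2 (by linarith)
  have hi1 : κ⁻¹ < 1 := inv_lt_one_of_one_lt₀ (by linarith)
  have hc : ContinuousOn (fun x => scaledMap κ (scaledMap κ x)) (Icc κ⁻¹ 1) :=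
    (continuousOn_iterate hκ 2).mono fun x hx => hi.trans_le hx.1
  refine intermediate_value_Ioc hi1.le hc ⟨?_, ?_⟩
  · simp only [apply_inv]
    linarith
  · simp only [apply_one]
    exact (le_top_iff (by linarith) hκ).2 h1

/-- Consequence used below: x₃ < x₂ = φ²(x₃) forces x₂ ≤ φ²(1). -/
theorem sq_le_max (h1 : 1 < κ) (hκ : κ < 2) (hx : 2 - κ ≤ x) :
    scaledMap κ (scaledMap κ x) ≤ max (scaledMap κ (2 - κ)) x := by
  have hx0 : 0 < x := by linarith
  refine (le_max h1 hκ (two_sub_le hx0)).trans ?_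
  exact max_le (le_max_left _ _) (le_max h1 hκ hx)

/-- Here x₁ is the smaller point of the 2-cycle. Since pq = 1/2, the preimages of p are q and 1/q =
2p, and those of q are p and 1/p = 2q, where 2q ≥ κ. -/
theorem not_turbulent_of_twoCycle_fst {p q x₂ x₃ : ℝ} (h1 : 1 < κ) (hκ : κ < 5 / 3) (hp : 0 < p)
    (hpq : p ≤ q) (hadd : p + q = κ) (hmul : p * q = 1 / 2) (hqp : scaledMap κ q = p)
    (hpq' : scaledMap κ p = q) (h2 : 2 - κ ≤ x₂) (h3 : 2 - κ ≤ x₃)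
    (e21 : scaledMap κ (scaledMap κ x₂) = p) (e32 : scaledMap κ (scaledMap κ x₃) = x₂) :
    ¬(p < x₃ ∧ x₃ < x₂) ∧ ¬(x₂ < x₃ ∧ x₃ < p) := by
  have hκ2 : κ < 2 := by linarith
  have hx2 : 0 < x₂ := by linarith
  have hx3 : 0 < x₃ := by linarith
  have hq : 0 < q := by linarith
  have hp1 : p < 1 := by nlinarith
  have htop : scaledMap κ (2 - κ) < κ := by
    rw [← not_le, le_top_iff h1 hκ2]
    linarith
  have hy2 := pos hκ2 hx2
  have hpre : scaledMap κ x₂ = q ∨ scaledMap κ x₂ = 2 * p := by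
    rw [← hqp, eq_iff hy2 hq] at e21
    refine e21.imp id fun h => ?_
    have : (scaledMap κ x₂ - 2 * p) * q = 0 := by linarith
    rcases mul_eq_zero.1 this with h | h <;> linarith
  refine ⟨fun ⟨ha, hb⟩ => ?_, fun ⟨ha, hb⟩ => ?_⟩
  · have hv : x₂ < κ := by
      have := sq_le_max h1 hκ2 h3
      rw [e32, le_max_iff] at this
      rcases this with h | h <;> linarith
    rcases hpre with h | h
    · rw [← hpq', eq_iff hx2 hp] at h
      rcases h with h | h
      · linarith
      · have : x₂ = 2 * q := by
          have : p * (x₂ - 2 * q) = 0 := by linarith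
          rcases mul_eq_zero.1 this with h | h <;> linarith
        linarith
    -- Otherwise 2p = φ(x₂) < φ(κ) = 1/κ, whereas 2pκ = 2p² + 1 > 1.
    · have hx2' : x₂ ≤ 1 := by
        by_contra! hc
        have := lt_of_one_le (κ := κ) hc.le hv
        rw [h, apply_self] at this
        have h5 : 2 * p * κ < κ⁻¹ * κ := mul_lt_mul_of_pos_right this (by linarith)
        rw [inv_mul_cancel₀ (by linarith)] at h5
        nlinarith
      have hl := lt_of_le_one (κ := κ) hx3 hb hx2'
      have hr := lt_of_le_one (κ := κ) hp ha (by linarith)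
      rw [h] at hl
      rw [hpq'] at hr
      -- φ(x₃) lies strictly between 2p = 1/q and q, so applying φ once more gives x₂ < p.
      have := lt_of_one_lt_mul (κ := κ) (by linarith) hr (by nlinarith)
      rw [hqp, e32] at this
      linarith
  · have hl := lt_of_le_one (κ := κ) hx2 (ha.trans hb) hp1.le
    rw [hpq'] at hl
    have hh : scaledMap κ x₂ = 2 * p := hpre.resolve_left hl.ne'
    have hv : 2 * p ≤ scaledMap κ (2 - κ) := by
      rw [← hh]
      exact le_of_mul_le_one (by linarith) h2 (by nlinarith)
    rw [hh] at hl
    have hq1 : q < 1 := by nlinarith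
    -- This gives κ > 3/2, but p ≤ q < 2p gives (q - 2p)(2q - p) < 0, that is κ² < 9/4.
    have := (one_lt_top_iff h1 hκ2).1 (by nlinarith)
    nlinarith

/-- Now x₁ is the larger point. The candidates for x₂ other than q are 2p and points at or above 2q;
the latter exceed φ²(1). -/
theorem not_turbulent_of_twoCycle_snd {p q x₂ x₃ : ℝ} (h1 : 1 < κ) (hκ : κ < 5 / 3) (hp : 0 < p)
    (hpq : p ≤ q) (hadd : p + q = κ) (hmul : p * q = 1 / 2) (hqp : scaledMap κ q = p)
    (hpq' : scaledMap κ p = q) (h2 : 2 - κ ≤ x₂) (h3 : 2 - κ ≤ x₃)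
    (e21 : scaledMap κ (scaledMap κ x₂) = q) (e32 : scaledMap κ (scaledMap κ x₃) = x₂) :
    ¬(q < x₃ ∧ x₃ < x₂) ∧ ¬(x₂ < x₃ ∧ x₃ < q) := by
  have hκ2 : κ < 2 := by linarith
  have hx2 : 0 < x₂ := by linarith
  have hx3 : 0 < x₃ := by linarith
  have hq : 0 < q := by linarith
  have hp1 : p < 1 := by nlinarith
  have htop : scaledMap κ (2 - κ) < κ := by
    rw [← not_le, le_top_iff h1 hκ2]
    linarith
  have hv (h : x₃ < x₂) : x₂ ≤ scaledMap κ (2 - κ) := by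
    have := sq_le_max h1 hκ2 h3
    rw [e32, le_max_iff] at this
    rcases this with h | h <;> linarith
  have hy2 := pos hκ2 hx2
  have hpre : scaledMap κ x₂ = p ∨ scaledMap κ x₂ = 2 * q := by
    rw [← hpq', eq_iff hy2 hp] at e21
    refine e21.imp id fun h => ?_
    have : (scaledMap κ x₂ - 2 * q) * p = 0 := by linarith
    rcases mul_eq_zero.1 this with h | h <;> linarith
  rcases hpre with h | h
  · rw [← hqp, eq_iff hx2 hq] at h
    rcases h with h | h
    · constructor <;> rintro ⟨ha, hb⟩ <;> linarith
    have hx : x₂ = 2 * p := by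
      have : q * (x₂ - 2 * p) = 0 := by linarith
      rcases mul_eq_zero.1 this with h | h <;> linarith
    refine ⟨fun ⟨ha, hb⟩ => ?_, fun ⟨ha, hb⟩ => ?_⟩
    · have hq1 : q < 1 := by nlinarith
      have := (one_lt_top_iff h1 hκ2).1 (by nlinarith [hv hb])
      nlinarith
    · have hl := lt_of_one_lt_mul (κ := κ) hx3 hb (by nlinarith)
      rw [hqp] at hl
      have := lt_of_le_one (κ := κ) (pos hκ2 hx3) hl hp1.le
      rw [hpq', e32] at this
      linarith
  · have := le_max h1 hκ2 h2
    rw [h, le_max_iff] at this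
    have hx : 2 * q ≤ x₂ := this.resolve_left (by linarith)
    refine ⟨fun ⟨ha, hb⟩ => ?_, fun ⟨ha, hb⟩ => ?_⟩
    · linarith [hv hb]
    · linarith

theorem not_turbulent {x₁ x₂ x₃ : ℝ} (h1 : 1 < κ) (hκ : κ < 5 / 3)
    (hx1 : 2 - κ ≤ x₁) (h2 : 2 - κ ≤ x₂) (h3 : 2 - κ ≤ x₃)
    (e11 : scaledMap κ (scaledMap κ x₁) = x₁)
    (e21 : scaledMap κ (scaledMap κ x₂) = x₁) (e32 : scaledMap κ (scaledMap κ x₃) = x₂) :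
    ¬(x₁ < x₃ ∧ x₃ < x₂) ∧ ¬(x₂ < x₃ ∧ x₃ < x₁) := by
  have hκ2 : κ < 2 := by linarith
  have hκ0 : 0 < κ := by linarith
  have hx10 : 0 < x₁ := by linarith
  have hx20 : 0 < x₂ := by linarith
  have htop : scaledMap κ (2 - κ) < κ := by
    rw [← not_le, le_top_iff h1 hκ2]
    linarith
  rcases sq_eq_self hκ2 hx10 e11 with h | h
  · obtain rfl : x₁ = κ⁻¹ := (inv_eq_of_mul_eq_one_right h).symm
    have hinv : κ⁻¹ < κ := (inv_lt_one_of_one_lt₀ h1).trans h1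
    have hmul : κ⁻¹ * κ = 1 := inv_mul_cancel₀ hκ0.ne'
    -- The φ²-preimages of 1/κ are 1/κ, κ and the preimages of κ; by `le_max` and φ²(1) < κ, the
    -- last are at least κ.
    have hx2 : x₂ = κ⁻¹ ∨ κ ≤ x₂ := by
      have hy := pos hκ2 hx20
      have e : scaledMap κ (scaledMap κ x₂) = scaledMap κ κ⁻¹ := by rw [e21, apply_inv]
      rcases (eq_iff hy hx10).1 e with e | e
      · rw [← apply_inv (κ := κ), eq_iff hx20 hx10] at e
        refine e.imp id fun e => ?_
        have : κ⁻¹ * (x₂ - κ) = 0 := by linarith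
        rcases mul_eq_zero.1 this with h | h <;> linarith
      · right
        have : κ⁻¹ * (scaledMap κ x₂ - κ) = 0 := by linarith
        have e' : scaledMap κ x₂ = κ := by
          rcases mul_eq_zero.1 this with h | h <;> linarith
        have := le_max h1 hκ2 h2
        rw [e', le_max_iff] at this
        exact this.resolve_left (by linarith)
    refine ⟨fun ⟨ha, hb⟩ => ?_, fun ⟨ha, hb⟩ => ?_⟩
    · have := sq_le_max h1 hκ2 h3
      rw [e32, le_max_iff] at this
      rcases hx2 with h' | h' <;> rcases this with h'' | h'' <;> linarith
    · rcases hx2 with h' | h' <;> linarith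
  · have hmul : x₁ * (κ - x₁) = 1 / 2 := by linarith
    have hw : 0 < κ - x₁ := pos_of_mul_pos_right (by rw [hmul]; norm_num) hx10.le
    have hinv : x₁⁻¹ = 2 * (κ - x₁) := inv_eq_of_mul_eq_one_right (by linarith)
    have hinv' : (κ - x₁)⁻¹ = 2 * x₁ := inv_eq_of_mul_eq_one_right (by linarith)
    have ea : scaledMap κ x₁ = κ - x₁ := by
      unfold scaledMap
      rw [hinv]
      ring
    have eb : scaledMap κ (κ - x₁) = x₁ := by
      unfold scaledMap
      rw [hinv']
      ring
    rcases le_total x₁ (κ - x₁) with hle | hle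
    · exact not_turbulent_of_twoCycle_fst h1 hκ hx10 hle (by ring) hmul eb ea h2 h3 e21 e32
    · exact not_turbulent_of_twoCycle_snd h1 hκ hw hle (by ring) (by linarith) ea eb h2 h3 e21 e32

/-! ### Cycles of odd period -/

theorem not_odd_cycle {n : ℕ} (h1 : 1 < κ) (hκ : κ ≤ 5 / 3) (hx : 0 < x) (hn : Odd n)
    (hp : IsPeriodicPt (scaledMap κ) n x) : scaledMap κ x = x := by
  have hκ2 : κ < 2 := by linarith
  have hi : 0 < κ⁻¹ := inv_pos.2 (by linarith)
  have hi1 : κ⁻¹ < 1 := inv_lt_one_of_one_lt₀ h1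
  have htop : scaledMap κ (2 - κ) ≤ κ := by
    rw [← not_lt, lt_top_iff h1 hκ2]
    linarith
  obtain ⟨m, rfl⟩ := hn
  have hp' : scaledMap κ ((scaledMap κ)^[2 * m] x) = x :=
    (iterate_succ_apply' (scaledMap κ) (2 * m) x).symm.trans hp.eq
  have hlow : 2 - κ ≤ x := by
    rw [← hp']
    exact two_sub_le (iterate_pos hκ2 hx _)
  -- By `le_max`, the later orbit of a point above φ²(1) stays strictly below it, so it cannot
  -- return.
  have hup : x ≤ scaledMap κ (2 - κ) := by
    by_contra! hc
    have hlt : ∀ k : ℕ, (scaledMap κ)^[k + 1] x < x := by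
      intro k
      induction k with
      | zero =>
        refine lt_self hx ?_
        have := mul_lt_mul_of_pos_left ((inv_lt_top h1 hκ2).trans hc) (by linarith : 0 < κ)
        rwa [mul_inv_cancel₀ (by linarith)] at this
      | succ k ih =>
        have h3 : 2 - κ ≤ (scaledMap κ)^[k + 1] x := by
          rw [iterate_succ_apply']
          exact two_sub_le (iterate_pos hκ2 hx _)
        rw [iterate_succ_apply']
        exact (le_max h1 hκ2 h3).trans_lt (max_lt hc ih)
    exact (hlt (2 * m)).ne hp.eq
  have hLR : MapsTo (scaledMap κ) (Icc (2 - κ) κ⁻¹) (Icc κ⁻¹ (scaledMap κ (2 - κ))) := by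
    intro y hy
    constructor
    · have := hy.1
      have := hy.2
      exact apply_inv.symm.le.trans (le_of_mul_le_one (by linarith) hy.2 (by nlinarith))
    · have := hy.1
      have := hy.2
      exact le_of_mul_le_one (by linarith) hy.1 (by nlinarith)
  -- The step that needs κ ≤ 5/3: φ(y) ≤ 1/κ holds on [1/κ, κ], and φ²(1) ≤ κ.
  have hRL : MapsTo (scaledMap κ) (Icc κ⁻¹ (scaledMap κ (2 - κ))) (Icc (2 - κ) κ⁻¹) := by
    intro y hy
    refine ⟨two_sub_le (hi.trans_le hy.1), ?_⟩
    refine (le_of_mul_le_one hi hy.1 ?_).trans apply_inv.le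
    rw [inv_mul_le_iff₀ (by linarith)]
    linarith [hy.2]
  have hfix : x = κ⁻¹ := by
    rw [iterate_mul] at hp'
    rcases le_total x κ⁻¹ with h | h
    · have := hLR ((hRL.comp hLR).iterate m ⟨hlow, h⟩)
      have h4 := this.1
      exact le_antisymm h (hp' ▸ h4)
    · have := hRL ((hLR.comp hRL).iterate m ⟨h, hup⟩)
      have h4 := this.2
      exact le_antisymm (hp' ▸ h4) h
  rw [hfix, apply_inv]

/-- The quadratic factor of `sq_sub_self` is convex and negative at both 1/κ and 1, hence on the
whole interval. -/
theorem self_lt_sq (h1 : 5 / 3 < κ) (hκ : κ < 2) (hx : x ∈ Ioc κ⁻¹ 1) :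
    x < scaledMap κ (scaledMap κ x) := by
  have hκ0 : 0 < κ := by linarith
  have hx0 : 0 < x := (inv_pos.2 hκ0).trans hx.1
  have hx1 : 1 < κ * x := by
    have := mul_lt_mul_of_pos_left hx.1 hκ0
    rwa [mul_inv_cancel₀ hκ0.ne'] at this
  rw [← sub_pos, sq_sub_self hκ hx0]
  have := pos hκ hx0
  refine div_pos (mul_pos_of_neg_of_neg (by linarith) ?_) (by positivity)
  have h2 := hx.2
  nlinarith [mul_nonneg (sub_nonneg.2 h2) (sub_nonneg.2 hx1.le)]

theorem exists_preimage (h1 : 5 / 3 < κ) (hκ : κ < 2) (hx : x ∈ Ioc κ⁻¹ 1) :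
    ∃ y ∈ Ioo κ⁻¹ x, scaledMap κ (scaledMap κ y) = x := by
  have hi : 0 < κ⁻¹ := inv_pos.2 (by linarith)
  have hc : ContinuousOn (fun x => scaledMap κ (scaledMap κ x)) (Icc κ⁻¹ x) :=
    (continuousOn_iterate hκ 2).mono fun x hx => hi.trans_le hx.1
  refine intermediate_value_Ioo hx.1.le hc ⟨?_, self_lt_sq h1 hκ hx⟩
  simp only [apply_inv]
  exact hx.1

open Filter Topology in
theorem exists_odd_cycle (h1 : 5 / 3 < κ) (hκ : κ < 2) :
    ∃ x, 0 < x ∧ scaledMap κ x ≠ x ∧ ∃ n, Odd n ∧ IsPeriodicPt (scaledMap κ) n x := by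
  have hκ0 : 0 < κ := by linarith
  have hi : 0 < κ⁻¹ := inv_pos.2 hκ0
  have hi1 : κ⁻¹ < 1 := inv_lt_one_of_one_lt₀ (by linarith)
  choose! g hg hgg using fun x (hx : x ∈ Ioc κ⁻¹ 1) => exists_preimage h1 hκ hx
  -- A decreasing backward φ²-orbit of 1. Its limit is fixed by φ², so by `self_lt_sq` it is 1/κ.
  set y : ℕ → ℝ := fun k => g^[k] 1
  have hy (k : ℕ) : y k ∈ Ioc κ⁻¹ 1 :=
    MapsTo.iterate (f := g) (s := Ioc κ⁻¹ 1)
      (fun x hx => ⟨(hg x hx).1, (hg x hx).2.le.trans hx.2⟩) k ⟨hi1, le_rfl⟩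
  have hsucc (k : ℕ) : y (k + 1) = g (y k) := iterate_succ_apply' g k 1
  have hlt (k : ℕ) : y (k + 1) < y k := by
    rw [hsucc]
    exact (hg _ (hy k)).2
  have hback (k : ℕ) : (scaledMap κ)^[2] (y (k + 1)) = y k := by
    rw [hsucc]
    exact hgg _ (hy k)
  have hone (k : ℕ) : (scaledMap κ)^[2 * k] (y k) = 1 := by
    induction k with
    | zero => rfl
    | succ k ih => rw [mul_add, mul_one, iterate_add_apply, hback, ih]
  have hlim : Tendsto y atTop (𝓝 κ⁻¹) := by
    have hbdd : BddBelow (range y) := ⟨κ⁻¹, by rintro _ ⟨k, rfl⟩; exact (hy k).1.le⟩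
    have ht := tendsto_atTop_ciInf (antitone_nat_of_succ_le fun k => (hlt k).le) hbdd
    set L := ⨅ k, y k
    have hL1 : κ⁻¹ ≤ L := ge_of_tendsto' ht fun k => (hy k).1.le
    have hL2 : L ≤ 1 := le_of_tendsto' ht fun k => (hy k).2
    have hL : (scaledMap κ)^[2] L = L := by
      have hc := (continuousOn_iterate hκ 2).continuousAt (Ioi_mem_nhds (hi.trans_le hL1))
      have ht' := hc.tendsto.comp (ht.comp (tendsto_add_atTop_nat 1))
      refine tendsto_nhds_unique ht' (ht.congr fun k => ?_)
      exact (hback k).symm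
    rcases hL1.eq_or_lt with h | h
    · rwa [h]
    · exact absurd hL (self_lt_sq h1 hκ ⟨h, hL2⟩).ne'
  have htop : κ⁻¹ < (scaledMap κ)^[3] 1 := by
    have := lt_of_one_le (κ := κ) (by linarith) ((lt_top_iff (by linarith) hκ).2 h1)
    rwa [apply_self, ← apply_one] at this
  obtain ⟨k, hk⟩ := (hlim.eventually (gt_mem_nhds htop)).exists
  -- The iterate 2k+3 sends y (k+1) to φ(1), below it, and y k to φ³(1), above it. The crossing lies
  -- to the right of 1/κ, so it is not a fixed point of φ.
  have hc : ContinuousOn (fun x => (scaledMap κ)^[2 * k + 3] x - x) (Icc (y (k + 1)) (y k)) :=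
    ((continuousOn_iterate hκ _).sub continuousOn_id).mono
      fun x hx => (hi.trans (hy (k + 1)).1).trans_le hx.1
  have hl : (scaledMap κ)^[2 * k + 3] (y (k + 1)) - y (k + 1) ≤ 0 := by
    rw [show 2 * k + 3 = 1 + 2 * (k + 1) by ring, iterate_add_apply, hone, iterate_one, apply_one]
    have := (hy (k + 1)).1
    have h3 : 2 - κ ≤ κ⁻¹ := by
      rw [← apply_inv (κ := κ)]
      exact two_sub_le hi
    linarith
  have hr : 0 ≤ (scaledMap κ)^[2 * k + 3] (y k) - y k := by
    rw [add_comm, iterate_add_apply, hone]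
    linarith
  obtain ⟨x, hx, hx0⟩ := intermediate_value_Icc (hlt k).le hc ⟨hl, hr⟩
  have hxi : κ⁻¹ < x := (hy (k + 1)).1.trans_le hx.1
  refine ⟨x, hi.trans hxi, fun h => ?_, 2 * k + 3, ⟨k + 1, by ring⟩, sub_eq_zero.1 hx0⟩
  rw [eq_self_iff (hi.trans hxi)] at h
  exact hxi.ne (inv_eq_of_mul_eq_one_right h)

end scaledMap

/-! ### Conjugacy and transfer to the tâtonnement map -/

/-- The parameter of the scaled map conjugate to the tâtonnement map. -/
noncomputable def scaledParameter (α β lam : ℝ) : ℝ := 4 * lam * (1 - α) / criticalPrice β lam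

theorem criticalPrice_pos {β lam : ℝ} (hβ : 0 < β) (hlam : 0 < lam) : 0 < criticalPrice β lam :=
  Real.sqrt_pos.2 (by positivity)

theorem criticalPrice_sq {β lam : ℝ} (hβ : 0 < β) (hlam : 0 < lam) :
    criticalPrice β lam ^ 2 = 2 * lam * β :=
  Real.sq_sqrt (by positivity)

theorem scaledParameter_pos {α β lam : ℝ} (hα : α < 1) (hβ : 0 < β) (hlam : 0 < lam) :
    0 < scaledParameter α β lam :=
  div_pos (mul_pos (by positivity) (sub_pos.2 hα)) (criticalPrice_pos hβ hlam)

theorem scaledParameter_sq {α β lam : ℝ} (hβ : 0 < β) (hlam : 0 < lam) :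
    scaledParameter α β lam ^ 2 = 8 * (1 - α) ^ 2 * lam / β := by
  rw [scaledParameter, div_pow, criticalPrice_sq hβ hlam]
  field_simp
  ring

theorem tatonnement_mul {α β lam : ℝ} (hβ : 0 < β) (hlam : 0 < lam) {x : ℝ} (hx : x ≠ 0) :
    tatonnement α β lam (criticalPrice β lam * x) =
      criticalPrice β lam * scaledMap (scaledParameter α β lam) x := by
  have hs := (criticalPrice_pos hβ hlam).ne'
  have h2 := criticalPrice_sq hβ hlam
  unfold tatonnement excessDemand scaledMap scaledParameter
  field_simp
  linear_combination -h2

section Transfer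

variable {α β lam : ℝ}

local notation "s" => criticalPrice β lam
local notation "κ" => scaledParameter α β lam
local notation "f" => tatonnement α β lam

theorem tatonnement_sq_mul (hβ : 0 < β) (hlam : 0 < lam) (hκ : κ < 2) {x : ℝ} (hx : 0 < x) :
    f (f (s * x)) = s * scaledMap κ (scaledMap κ x) := by
  rw [tatonnement_mul hβ hlam hx.ne', tatonnement_mul hβ hlam (scaledMap.pos hκ hx).ne']

theorem tatonnement_iterate_mul (hβ : 0 < β) (hlam : 0 < lam) (hκ : κ < 2) {x : ℝ} (hx : 0 < x)
    (n : ℕ) : f^[n] (s * x) = s * (scaledMap κ)^[n] x := by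
  induction n with
  | zero => rfl
  | succ n ih =>
    rw [iterate_succ_apply', ih, tatonnement_mul hβ hlam (scaledMap.iterate_pos hκ hx n).ne',
      iterate_succ_apply']

/-- The added unit keeps the critical point 1 interior even when φ²(1) ≤ 1. -/
theorem priceInterval_eq (hβ : 0 < β) (hlam : 0 < lam) (hκ : κ < 2) :
    priceInterval α β lam = Icc (s * (2 - κ)) (s * (scaledMap κ (2 - κ) + 1)) := by
  have h1 := tatonnement_mul (α := α) hβ hlam one_ne_zero
  have h2 := tatonnement_sq_mul hβ hlam hκ one_pos
  rw [mul_one, scaledMap.apply_one] at h1 h2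
  rw [priceInterval, iterate_succ_apply, iterate_one, h1, ← h1, h2, h1, mul_add, mul_one]

theorem mul_mem_priceInterval (hβ : 0 < β) (hlam : 0 < lam) (hκ : κ < 2) {x : ℝ} :
    s * x ∈ priceInterval α β lam ↔ x ∈ Icc (2 - κ) (scaledMap κ (2 - κ) + 1) := by
  have hs := criticalPrice_pos hβ hlam
  rw [priceInterval_eq hβ hlam hκ, mem_Icc, mem_Icc, mul_le_mul_iff_right₀ hs,
    mul_le_mul_iff_right₀ hs]

theorem exists_mul_of_mem_priceInterval (hβ : 0 < β) (hlam : 0 < lam) (hκ : κ < 2) {p : ℝ}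
    (hp : p ∈ priceInterval α β lam) :
    ∃ x ∈ Icc (2 - κ) (scaledMap κ (2 - κ) + 1), s * x = p := by
  have hs := criticalPrice_pos hβ hlam
  refine ⟨p / s, ?_, mul_div_cancel₀ p hs.ne'⟩
  rw [← mul_mem_priceInterval hβ hlam hκ, mul_div_cancel₀ p hs.ne']
  exact hp

theorem mapsTo_priceInterval (hβ : 0 < β) (hlam : 0 < lam) (h1 : 1 < κ) (hκ : κ < 2) :
    MapsTo f (priceInterval α β lam) (priceInterval α β lam) := by
  intro p hp
  obtain ⟨x, hx, rfl⟩ := exists_mul_of_mem_priceInterval hβ hlam hκ hp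
  have hx0 : 0 < x := by linarith [hx.1]
  rw [tatonnement_mul hβ hlam hx0.ne', mul_mem_priceInterval hβ hlam hκ]
  exact ⟨scaledMap.two_sub_le hx0,
    (scaledMap.le_max h1 hκ hx.1).trans (max_le (by linarith) hx.2)⟩

theorem continuous_restrict (hβ : 0 < β) (hlam : 0 < lam) (hκ : κ < 2)
    (hE : MapsTo f (priceInterval α β lam) (priceInterval α β lam)) :
    Continuous (hE.restrict f _ _) := by
  refine ContinuousOn.mapsToRestrict ?_ hE
  have hc : ContinuousOn f {0}ᶜ := by
    unfold tatonnement excessDemand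
    refine continuousOn_id.add (continuousOn_const.mul ?_)
    exact (continuousOn_const.div continuousOn_id fun x hx => hx).sub continuousOn_const
  refine hc.mono fun p hp => ?_
  obtain ⟨x, hx, rfl⟩ := exists_mul_of_mem_priceInterval hβ hlam hκ hp
  exact mul_ne_zero (criticalPrice_pos hβ hlam).ne' (by linarith [hx.1])

theorem inClassG_restrict (hβ : 0 < β) (hlam : 0 < lam) (h1 : 1 < κ) (hκ : κ < 2)
    (hE : MapsTo f (priceInterval α β lam) (priceInterval α β lam)) :
    InClassG (hE.restrict f _ _) := by
  have hs := criticalPrice_pos hβ hlam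
  have hv : 2 - κ < scaledMap κ (2 - κ) := scaledMap.two_sub_lt (by linarith) (by linarith)
  have hsm : s * 1 ∈ priceInterval α β lam := by
    rw [mul_mem_priceInterval hβ hlam hκ]
    constructor <;> linarith
  have ea := tatonnement_mul (α := α) hβ hlam one_ne_zero
  have eb := tatonnement_sq_mul hβ hlam hκ one_pos
  have el : f (s * (2 - κ)) = s * scaledMap κ (2 - κ) := tatonnement_mul hβ hlam (by linarith)
  have hvκ : 1 < κ * (scaledMap κ (2 - κ) + 1) := by nlinarith
  have er : f (s * (scaledMap κ (2 - κ) + 1)) = s * scaledMap κ (scaledMap κ (2 - κ) + 1) :=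
    tatonnement_mul hβ hlam (by linarith)
  rw [mul_one, scaledMap.apply_one] at ea eb
  rw [mul_one] at hsm
  have eb' : f^[2] s + s = s * (scaledMap κ (2 - κ) + 1) := by
    rw [iterate_succ_apply, iterate_one, eb]
    ring
  have hlt {x y : ℝ} : s * x < s * y ↔ x < y := mul_lt_mul_iff_right₀ hs
  refine ⟨continuous_restrict hβ hlam hκ hE, ?_, ⟨s, hsm⟩, ?_, ?_, ?_, ?_, ?_, ?_, ?_⟩
  · exact hsm.1.trans hsm.2
  · change f s < s
    rw [ea]
    nlinarith
  · change s < f^[2] s + s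
    rw [eb']
    nlinarith
  · rintro ⟨p, hp⟩ hp' ⟨q, hq⟩ hq' hpq
    obtain ⟨x, hx, rfl⟩ := exists_mul_of_mem_priceInterval hβ hlam hκ hp
    obtain ⟨y, hy, rfl⟩ := exists_mul_of_mem_priceInterval hβ hlam hκ hq
    have hx0 : 0 < x := by linarith [hx.1]
    have hy0 : 0 < y := by linarith [hy.1]
    have hxy : x < y := hlt.1 hpq
    have hy1 : y ≤ 1 := by
      have : s * y ≤ s := hq'
      nlinarith
    change f (s * y) < f (s * x)
    rw [tatonnement_mul hβ hlam hx0.ne', tatonnement_mul hβ hlam hy0.ne', hlt]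
    exact scaledMap.lt_of_le_one hx0 hxy hy1
  · rintro ⟨p, hp⟩ hp' ⟨q, hq⟩ hq' hpq
    obtain ⟨x, hx, rfl⟩ := exists_mul_of_mem_priceInterval hβ hlam hκ hp
    obtain ⟨y, hy, rfl⟩ := exists_mul_of_mem_priceInterval hβ hlam hκ hq
    have hx0 : 0 < x := by linarith [hx.1]
    have hy0 : 0 < y := by linarith [hy.1]
    have hxy : x < y := hlt.1 hpq
    have hx1 : 1 ≤ x := by
      have : s ≤ s * x := hp'
      nlinarith
    change f (s * x) < f (s * y)
    rw [tatonnement_mul hβ hlam hx0.ne', tatonnement_mul hβ hlam hy0.ne', hlt]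
    exact scaledMap.lt_of_one_le hx1 hxy
  · change f s < f (f s)
    rw [ea, el, hlt]
    exact hv
  · change f (f^[2] s + s) < f^[2] s + s
    rw [eb', er, hlt]
    exact scaledMap.lt_self (by linarith) hvκ
  · rintro ⟨p, hp⟩ hp' -
    obtain ⟨x, hx, rfl⟩ := exists_mul_of_mem_priceInterval hβ hlam hκ hp
    have hx0 : 0 < x := by linarith [hx.1]
    have hx1 : 1 ≤ x := by
      have : s ≤ s * x := hp'
      nlinarith
    change f (s * x) < s * x
    rw [tatonnement_mul hβ hlam hx0.ne', hlt]
    exact scaledMap.lt_self hx0 (by nlinarith)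

theorem turbulent_restrict_iff (hβ : 0 < β) (hlam : 0 < lam) (h1 : 1 < κ) (hκ : κ < 2)
    (hE : MapsTo f (priceInterval α β lam) (priceInterval α β lam)) :
    Turbulent (hE.restrict f _ _)^[2] ↔ 5 / 3 ≤ κ := by
  have hs := criticalPrice_pos hβ hlam
  have hlt {x y : ℝ} : s * x < s * y ↔ x < y := mul_lt_mul_iff_right₀ hs
  constructor
  · rintro ⟨-, ⟨p₁, hp₁⟩, ⟨p₂, hp₂⟩, ⟨p₃, hp₃⟩, e21, e11, e32, hor⟩
    obtain ⟨x₁, hx₁, rfl⟩ := exists_mul_of_mem_priceInterval hβ hlam hκ hp₁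
    obtain ⟨x₂, hx₂, rfl⟩ := exists_mul_of_mem_priceInterval hβ hlam hκ hp₂
    obtain ⟨x₃, hx₃, rfl⟩ := exists_mul_of_mem_priceInterval hβ hlam hκ hp₃
    have e21 : f (f (s * x₂)) = s * x₁ := congrArg Subtype.val e21
    have e11 : f (f (s * x₁)) = s * x₁ := congrArg Subtype.val e11
    have e32 : f (f (s * x₃)) = s * x₂ := congrArg Subtype.val e32
    rw [tatonnement_sq_mul hβ hlam hκ (by linarith [hx₂.1])] at e21
    rw [tatonnement_sq_mul hβ hlam hκ (by linarith [hx₁.1])] at e11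
    rw [tatonnement_sq_mul hβ hlam hκ (by linarith [hx₃.1])] at e32
    by_contra! hc
    have hn := scaledMap.not_turbulent h1 hc hx₁.1 hx₂.1 hx₃.1 (mul_left_cancel₀ hs.ne' e11)
      (mul_left_cancel₀ hs.ne' e21) (mul_left_cancel₀ hs.ne' e32)
    rcases hor with ⟨ha, hb⟩ | ⟨ha, hb⟩
    · exact hn.1 ⟨hlt.1 ha, hlt.1 hb⟩
    · exact hn.2 ⟨hlt.1 ha, hlt.1 hb⟩
  · intro hk
    obtain ⟨x, hx, hxκ⟩ := scaledMap.exists_turbulent hk hκ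
    have hi : 0 < (κ)⁻¹ := inv_pos.2 (by linarith)
    have ha : 2 - κ ≤ (κ)⁻¹ := by
      conv_rhs => rw [← scaledMap.apply_inv]
      exact scaledMap.two_sub_le hi
    have hi1 : (κ)⁻¹ < 1 := inv_lt_one_of_one_lt₀ h1
    have hv := (scaledMap.le_top_iff h1 hκ).2 hk
    have hmem {y : ℝ} (hy : 2 - κ ≤ y) (hy' : y ≤ κ) : s * y ∈ priceInterval α β lam :=
      (mul_mem_priceInterval hβ hlam hκ).2 ⟨hy, by linarith⟩
    refine ⟨(continuous_restrict hβ hlam hκ hE).iterate 2, ⟨s * (κ)⁻¹, hmem ha (by linarith)⟩,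
      ⟨s * κ, hmem (by linarith) le_rfl⟩, ⟨s * x, hmem (by linarith [hx.1]) (by linarith [hx.2])⟩,
      Subtype.ext ?_, Subtype.ext ?_, Subtype.ext ?_, .inl ⟨?_, ?_⟩⟩
    · change f (f (s * κ)) = s * (κ)⁻¹
      rw [tatonnement_sq_mul hβ hlam hκ (by linarith), scaledMap.apply_self, scaledMap.apply_inv]
    · change f (f (s * (κ)⁻¹)) = s * (κ)⁻¹
      rw [tatonnement_sq_mul hβ hlam hκ hi, scaledMap.apply_inv, scaledMap.apply_inv]
    · change f (f (s * x)) = s * κ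
      rw [tatonnement_sq_mul hβ hlam hκ (hi.trans hx.1), hxκ]
    · exact hlt.2 hx.1
    · exact hlt.2 (by linarith [hx.2])

theorem hasOddPeriodCycle_iff (hβ : 0 < β) (hlam : 0 < lam) (h1 : 1 < κ) (hκ : κ < 2) :
    HasOddPeriodCycle (Ioi 0) f ↔ 5 / 3 < κ := by
  have hs := criticalPrice_pos hβ hlam
  have hper {x : ℝ} (hx : 0 < x) (n : ℕ) :
      IsPeriodicPt f n (s * x) ↔ IsPeriodicPt (scaledMap κ) n x := by
    rw [IsPeriodicPt, IsFixedPt, tatonnement_iterate_mul hβ hlam hκ hx,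
      mul_right_inj' hs.ne', IsPeriodicPt, IsFixedPt]
  constructor
  · rintro ⟨p, hp, hodd, hgt⟩
    obtain ⟨x, rfl⟩ : ∃ x, s * x = p := ⟨p / s, mul_div_cancel₀ p hs.ne'⟩
    have hx : 0 < x := pos_of_mul_pos_right (hp 0) hs.le
    by_contra! hc
    have hfix := scaledMap.not_odd_cycle h1 hc hx hodd
      ((hper hx _).1 (isPeriodicPt_minimalPeriod _ _))
    have := ((hper hx 1).2 hfix).minimalPeriod_le one_pos
    omega
  · intro hk
    obtain ⟨x, hx, hne, n, hn, hpn⟩ := scaledMap.exists_odd_cycle hk hκ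
    have hpn' := (hper hx n).2 hpn
    -- The least period divides the odd n, hence is odd; it is not 1 because x is not fixed.
    refine ⟨s * x, fun k => ?_, hn.of_dvd_nat hpn'.minimalPeriod_dvd, ?_⟩
    · rw [tatonnement_iterate_mul hβ hlam hκ hx]
      exact mul_pos hs (scaledMap.iterate_pos hκ hx k)
    · have h0 := hpn'.minimalPeriod_pos hn.pos
      refine lt_of_le_of_ne h0 fun h => hne ?_
      have := isPeriodicPt_minimalPeriod f (s * x)
      rw [← h] at this
      exact (hper hx 1).1 this

end Transfer

theorem theorem1 (α β lam : ℝ) (hα : α ∈ Set.Ioo (0 : ℝ) 1) (hβ : β ∈ Set.Ioo (0 : ℝ) 1)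
    (hlam : 0 < lam)
    (hlow : β / (8 * (1 - α) ^ 2) < lam) (hupp : lam < β / (2 * (1 - α) ^ 2)) :
    (∃ hE : Set.MapsTo (tatonnement α β lam) (priceInterval α β lam) (priceInterval α β lam),
      InClassG (hE.restrict (tatonnement α β lam) _ _) ∧
      (Turbulent ((hE.restrict (tatonnement α β lam) _ _)^[2]) ↔
        25 * β / (72 * (1 - α) ^ 2) ≤ lam ∧ lam < β / (2 * (1 - α) ^ 2))) ∧
    (HasOddPeriodCycle (Set.Ioi 0) (tatonnement α β lam) ↔
      25 * β / (72 * (1 - α) ^ 2) < lam ∧ lam < β / (2 * (1 - α) ^ 2)) := by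
  have hα' : 0 < 1 - α := sub_pos.2 hα.2
  have hβ' := hβ.1
  have h0 := scaledParameter_pos hα.2 hβ' hlam
  have hsq := scaledParameter_sq (α := α) hβ' hlam
  have h1 : 1 < scaledParameter α β lam := by
    rw [← one_lt_sq_iff₀ h0.le, hsq, lt_div_iff₀ hβ']
    rw [div_lt_iff₀ (by positivity)] at hlow
    linarith
  have h2 : scaledParameter α β lam < 2 := by
    rw [← pow_lt_pow_iff_left₀ h0.le zero_le_two two_ne_zero, hsq, div_lt_iff₀ hβ']
    rw [lt_div_iff₀ (by positivity)] at hupp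
    linarith
  have hle : 25 * β / (72 * (1 - α) ^ 2) ≤ lam ↔ 5 / 3 ≤ scaledParameter α β lam := by
    rw [← pow_le_pow_iff_left₀ (by norm_num) h0.le two_ne_zero, hsq, le_div_iff₀ hβ',
      div_le_iff₀ (by positivity)]
    constructor <;> intro <;> linarith
  have hlt : 25 * β / (72 * (1 - α) ^ 2) < lam ↔ 5 / 3 < scaledParameter α β lam := by
    rw [← pow_lt_pow_iff_left₀ (by norm_num) h0.le two_ne_zero, hsq, lt_div_iff₀ hβ',
      div_lt_iff₀ (by positivity)]
    constructor <;> intro <;> linarith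
  have hE := mapsTo_priceInterval hβ' hlam h1 h2
  refine ⟨⟨hE, inClassG_restrict hβ' hlam h1 h2 hE, ?_⟩, ?_⟩
  · rw [turbulent_restrict_iff hβ' hlam h1 h2 hE, hle, and_iff_left hupp]
  · rw [hasOddPeriodCycle_iff hβ' hlam h1 h2, hlt, and_iff_left hupp]
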